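/- A mass distribution on $\mathbb{R}^n$ is a finite positive Borel measure that is absolutely continuous with respect to Lebesgue measure. A hyperplane bisects a mass distribution $\mu$ if each of its two half-spaces has measure $\frac12\mu(\mathbb{R}^n)$, and hyperplanes are pairwise orthogonal if their normal lines are. Let $\Omega^\perp(2;m,n)$ denote the maximum number $k$ such that for any $m$ mass distributions $\mu_1,\dots,\mu_m$ on $\mathbb{R}^n$ there exist $k$ pairwise orthogonal (affine) hyperplanes, each of which bisects each $\mu_j$. Theorem. For $n=2,4,8$ one has $\Omega^\perp(2;2,n)=n-1$. That is, for any two mass distributions on $\mathbb{R}^n$ there exist $n-1$ pairwise orthogonal hyperplanes, each of which bisects both of them, and no integer larger than $n-1$ has this property. -/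

import Mathlib

open MeasureTheory

namespace MassPartition

/-- A mass distribution on `ℝⁿ`: a finite (positive) Borel measure which is absolutely continuous
with respect to Lebesgue measure. -/
structure IsMassDistribution {n : ℕ} (μ : Measure (EuclideanSpace ℝ (Fin n))) : Prop where
  finite : IsFiniteMeasure μ
  absolutelyContinuous : μ ≪ volume

/-- An affine hyperplane `{x | ⟪normal, x⟫ = offset}` of `ℝⁿ`, given by a unit normal vector and an
offset. Every hyperplane has exactly two such presentations, `(u, t)` and `(-u, -t)`, which
exchange its two half-spaces; the notions below do not depend on the choice. -/
structure Hyperplane (n : ℕ) where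
  normal : EuclideanSpace ℝ (Fin n)
  norm_normal : ‖normal‖ = 1
  offset : ℝ

namespace Hyperplane

variable {n : ℕ}

/-- The points of the hyperplane. -/
def carrier (H : Hyperplane n) : Set (EuclideanSpace ℝ (Fin n)) :=
  {x | inner ℝ H.normal x = H.offset}

/-- The closed half-space on the side of the normal vector. -/
def posHalfSpace (H : Hyperplane n) : Set (EuclideanSpace ℝ (Fin n)) :=
  {x | H.offset ≤ inner ℝ H.normal x}

/-- The closed half-space on the other side. -/
def negHalfSpace (H : Hyperplane n) : Set (EuclideanSpace ℝ (Fin n)) :=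
  {x | inner ℝ H.normal x ≤ H.offset}

/-- The linear span of the normal vectors of the hyperplane. -/
def perp (H : Hyperplane n) : Submodule ℝ (EuclideanSpace ℝ (Fin n)) :=
  Submodule.span ℝ {H.normal}

/-- `H` bisects `μ`: each of its two half-spaces has half of the total mass. -/
def Bisects (H : Hyperplane n) (μ : Measure (EuclideanSpace ℝ (Fin n))) : Prop :=
  μ H.posHalfSpace = μ Set.univ / 2 ∧ μ H.negHalfSpace = μ Set.univ / 2

end Hyperplane

/-- Hyperplanes are pairwise orthogonal when their normal lines are. -/
def PairwiseOrthogonal {n k : ℕ} (H : Fin k → Hyperplane n) : Prop :=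
  ∀ i j, i ≠ j → (H i).perp ⟂ (H j).perp

/-- The numbers `k` such that for any `m` mass distributions on `ℝⁿ` there are `k` pairwise
orthogonal hyperplanes, each of which bisects each of the `m` mass distributions.
The maximum of this set is `Ω^⊥(2; m, n)`. -/
def orthogonalBisectionNumbers (m n : ℕ) : Set ℕ :=
  {k | ∀ μ : Fin m → Measure (EuclideanSpace ℝ (Fin n)), (∀ j, IsMassDistribution (μ j)) →
    ∃ H : Fin k → Hyperplane n, PairwiseOrthogonal H ∧ ∀ i j, (H i).Bisects (μ j)}

end MassPartition

/-! Lower bound. Call a unit vector `u` good if some hyperplane with normal `u` bisects the first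
measure and leaves at least half of the second on the side of `u`. The good vectors form a closed
set `D` which, together with `-D`, covers the sphere. If `u` and `-u` are both good, the
intermediate value theorem in the offset gives a common bisector with normal `u`. In dimensions 2,
4, 8 the left multiplications `J i` by the imaginary units of ℂ, ℍ, 𝕆 are odd isometries with the `J
i v` pairwise orthogonal. Borsuk–Ulam for the `n - 1` closed sets `J i ⁻¹' D` on the sphere of `ℝⁿ`
gives one `v` with all `±J i v` in `D` (`mem_orthogonalBisectionNumbers_of_frame`).

Upper bound. A bisector of a ball passes through its centre, so common bisectors of two balls have
normals orthogonal to the line of centres; at most `n - 1` of these are orthonormal.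

Borsuk–Ulam is proved by mod 2 cochains on a cubical grid. The closed sets become antipodal sign
functions `s k`. Put `c 0 = 1` and `c (k+1) = δ (s k * c k)`. The faces of a cube with alternating
signs form a chain `h` with `∂h = h + (antipode of h)`, so `⟨h, c (k+1)⟩ = ⟨h, c k⟩ = … = 1`. A cell
with `c n ≠ 0` has a sign change of every `s k`, `k < n`, nearby; refining the grid and compactness
finish the argument. -/

namespace MassPartition

/-! ### Combinatorial Borsuk–Ulam on a cubical grid, mod 2. -/

section Cubical

variable {N : ℕ}

/-- The mod 2 sum of `f` over the facets of the cell with centre `y`, in the barycentric subdivision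
of the cubical lattice whose vertices are the points with odd coordinates; the cell is free in the
directions of the even coordinates of `y`. -/
def facetSum (f : (Fin N → ℤ) → ZMod 2) (y : Fin N → ℤ) : ZMod 2 :=
  ∑ i, if Even (y i) then f (y + Pi.single i 1) + f (y - Pi.single i 1) else 0

/-- The mod 2 sum of `h` over the cells which have the cell `z` as a facet. -/
def cofacetSum (h : (Fin N → ℤ) → ZMod 2) (z : Fin N → ℤ) : ZMod 2 :=
  ∑ i, if Odd (z i) then h (z + Pi.single i 1) + h (z - Pi.single i 1) else 0

theorem sum_offDiag_symm_eq_zero {ι : Type*} [Fintype ι] [DecidableEq ι] (Q : ι → ι → ZMod 2)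
    (hQ : ∀ i j, Q i j = Q j i) (h0 : ∀ i, Q i i = 0) : ∑ i, ∑ j, Q i j = 0 := by
  rw [← Fintype.sum_prod_type']
  refine Finset.sum_involution (fun p _ => (p.2, p.1)) ?_ ?_ ?_ ?_
  · intro p _
    rw [hQ p.2 p.1]
    exact CharTwo.add_self_eq_zero _
  · rintro ⟨i, j⟩ _ h h'
    obtain rfl : j = i := by simpa using congrArg Prod.fst h'
    exact h (h0 _)
  · intros; simp
  · intros; rfl

/-- This is `δδ = 0`: a face of codimension two lies in exactly two facets, and fixing the
directions in the orders `(i, j)` and `(j, i)` cancels. -/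
theorem facetSum_facetSum (f : (Fin N → ℤ) → ZMod 2) (y : Fin N → ℤ) :
    facetSum (facetSum f) y = 0 := by
  have key : ∀ i j, Even (y i) → ∀ ε : ℤ, (ε = 1 ∨ ε = -1) →
      ((Even ((y + Pi.single i ε : Fin N → ℤ) j)) ↔ i ≠ j ∧ Even (y j)) := by
    intro i j hi ε hε
    by_cases h : i = j
    · subst h
      rcases hε with rfl | rfl <;> simp [Int.even_add, hi]
    · simp [h, Ne.symm h]
  have : facetSum (facetSum f) y = ∑ i, ∑ j, if i ≠ j ∧ Even (y i) ∧ Even (y j) then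
      f (y + Pi.single i 1 + Pi.single j 1) + f (y + Pi.single i 1 - Pi.single j 1)
      + (f (y - Pi.single i 1 + Pi.single j 1) + f (y - Pi.single i 1 - Pi.single j 1)) else 0 := by
    unfold facetSum
    refine Finset.sum_congr rfl fun i _ => ?_
    split_ifs with hi
    · rw [← Finset.sum_add_distrib]
      refine Finset.sum_congr rfl fun j _ => ?_
      have h1 := key i j hi 1 (Or.inl rfl)
      have h2 := key i j hi (-1) (Or.inr rfl)
      rw [Pi.single_neg, ← sub_eq_add_neg] at h2
      simp only [h1, h2, hi, true_and]
      split_ifs <;> simp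
    · simp [hi]
  rw [this]
  refine sum_offDiag_symm_eq_zero _ (fun i j => ?_) (fun i => by simp)
  by_cases h : i ≠ j ∧ Even (y i) ∧ Even (y j)
  · rw [if_pos h, if_pos ⟨h.1.symm, h.2.2, h.2.1⟩, add_right_comm y (Pi.single i 1),
      sub_add_eq_add_sub y (Pi.single i 1) (Pi.single j 1), sub_right_comm y (Pi.single i 1),
      add_sub_right_comm y (Pi.single i 1) (Pi.single j 1)]
    ring
  · rw [if_neg h, if_neg fun h' => h ⟨h'.1.symm, h'.2.2, h'.2.1⟩]

theorem facetSum_add (f g : (Fin N → ℤ) → ZMod 2) (y : Fin N → ℤ) :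
    facetSum (fun z => f z + g z) y = facetSum f y + facetSum g y := by
  unfold facetSum
  rw [← Finset.sum_add_distrib]
  refine Finset.sum_congr rfl fun i _ => ?_
  split_ifs
  · ring
  · simp

theorem facetSum_neg (f : (Fin N → ℤ) → ZMod 2) (y : Fin N → ℤ) :
    facetSum f (-y) = facetSum (fun z => f (-z)) y := by
  unfold facetSum
  refine Finset.sum_congr rfl fun i _ => ?_
  simp only [Pi.neg_apply, even_neg, neg_add, neg_sub']
  split_ifs
  · rw [add_comm, sub_neg_eq_add, ← sub_eq_add_neg]
  · rfl

/-- The mod 2 count of flags of cells ending in the cell `y`, along which the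
functions `s 0, …, s (k - 1)` change successively. -/
def flagCount (s : ℕ → (Fin N → ℤ) → ZMod 2) : ℕ → (Fin N → ℤ) → ZMod 2
  | 0 => fun y => if ∀ i, Odd (y i) then 1 else 0
  | k + 1 => facetSum fun z => s k z * flagCount s k z

variable (s : ℕ → (Fin N → ℤ) → ZMod 2)

theorem facetSum_flagCount (k : ℕ) (y : Fin N → ℤ) : facetSum (flagCount s k) y = 0 := by
  cases k with
  | succ k => exact facetSum_facetSum _ _
  | zero =>
    refine Finset.sum_eq_zero fun i _ => ?_
    split_ifs with hi
    · have : (∀ j, Odd ((y + Pi.single i 1 : Fin N → ℤ) j)) ↔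
          ∀ j, Odd ((y - Pi.single i 1 : Fin N → ℤ) j) := by
        refine forall_congr' fun j => ?_
        by_cases h : j = i
        · subst h; simp only [Pi.add_apply, Pi.sub_apply, Pi.single_eq_same]; grind
        · simp [h]
      simp only [flagCount, this]
      exact CharTwo.add_self_eq_zero _
    · rfl

theorem exists_of_facetSum_ne_zero {f : (Fin N → ℤ) → ZMod 2} {y : Fin N → ℤ}
    (h : facetSum f y ≠ 0) : ∃ i, Even (y i) ∧ ∃ ε : ℤ, (ε = 1 ∨ ε = -1) ∧
      f (y + Pi.single i ε) ≠ 0 := by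
  obtain ⟨i, -, hi⟩ := Finset.exists_ne_zero_of_sum_ne_zero h
  split_ifs at hi with he
  · refine ⟨i, he, ?_⟩
    by_contra! hc
    have h1 := hc 1 (Or.inl rfl)
    have h2 := hc (-1) (Or.inr rfl)
    rw [Pi.single_neg, ← sub_eq_add_neg] at h2
    exact hi (by rw [h1, h2, add_zero])
  · exact absurd rfl hi

/-- The `k`-th cochain lives on cells of dimension `k`, since each coboundary frees one more
coordinate. -/
theorem card_odd_of_flagCount_ne_zero (k : ℕ) (y : Fin N → ℤ) (h : flagCount s k y ≠ 0) :
    (Finset.univ.filter fun i => Odd (y i)).card + k = N := by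
  induction k generalizing y with
  | zero =>
    have : ∀ i, Odd (y i) := by
      by_contra hc
      exact h (if_neg hc)
    simp [this]
  | succ k ih =>
    obtain ⟨i, hi, ε, hε, hz⟩ := exists_of_facetSum_ne_zero h
    have := ih _ (right_ne_zero_of_mul hz)
    have h2 : (Finset.univ.filter fun j => Odd ((y + Pi.single i ε : Fin N → ℤ) j)) =
        insert i (Finset.univ.filter fun j => Odd (y j)) := by
      ext j
      by_cases hj : j = i
      · subst hj
        rcases hε with rfl | rfl <;> simp [Int.odd_add, hi]
      · simp [hj]
    rw [h2, Finset.card_insert_of_notMem (by simpa using hi)] at this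
    omega

/-- As `flagCount s k` is a cocycle, the constant `s k y` may be added to the factor `s k`. A
nonzero value then forces `s k` to differ between `y` and one of its facets. -/
theorem flagCount_succ_eq (k : ℕ) (y : Fin N → ℤ) :
    flagCount s (k + 1) y = facetSum (fun z => (s k z + s k y) * flagCount s k z) y := by
  have h := facetSum_flagCount s k y
  have h2 : facetSum (fun z => s k y * flagCount s k z) y = 0 := by
    have : facetSum (fun z => s k y * flagCount s k z) y
        = s k y * facetSum (flagCount s k) y := by
      unfold facetSum
      rw [Finset.mul_sum]
      refine Finset.sum_congr rfl fun i _ => ?_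
      split_ifs
      · ring
      · simp
    rw [this, h, mul_zero]
  simp only [add_mul]
  rw [facetSum_add, h2, add_zero]
  rfl

/-- The antipode changes `s k * c k` by `c k`, whose coboundary vanishes. -/
theorem flagCount_neg (hs : ∀ k z, z ≠ 0 → s k (-z) = s k z + 1) (k : ℕ) (hk : k ≤ N)
    (y : Fin N → ℤ) : flagCount s k (-y) = flagCount s k y := by
  induction k generalizing y with
  | zero => simp [flagCount]
  | succ k ih =>
    have : (fun z => s k (-z) * flagCount s k (-z)) =
        fun z => s k z * flagCount s k z + flagCount s k z := by
      funext z
      rw [ih (by omega)]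
      by_cases h0 : flagCount s k z = 0
      · simp [h0]
      -- The point `0` is a cell of full dimension `N`, while `c k` is supported in dimension `k <
      -- N`.
      · have hz : z ≠ 0 := by
          rintro rfl
          have := card_odd_of_flagCount_ne_zero s k 0 h0
          simp at this
          omega
        rw [hs k z hz]
        ring
    change facetSum _ (-y) = facetSum _ y
    rw [facetSum_neg, this, facetSum_add, facetSum_flagCount, add_zero]

theorem exists_change_of_flagCount_ne_zero (k : ℕ) (y : Fin N → ℤ) (h : flagCount s k y ≠ 0)
    (i : ℕ) (hi : i < k) : ∃ a b : Fin N → ℤ, (∀ j, |a j - y j| ≤ k) ∧ (∀ j, |b j - y j| ≤ k) ∧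
      s i a ≠ s i b := by
  induction k generalizing y with
  | zero => omega
  | succ k ih =>
    rw [flagCount_succ_eq] at h
    obtain ⟨l, -, ε, hε, hz⟩ := exists_of_facetSum_ne_zero h
    set z : Fin N → ℤ := y + Pi.single l ε with hzdef
    have hzy : ∀ j, |z j - y j| ≤ 1 := by
      intro j
      by_cases hj : j = l
      · subst hj; rcases hε with rfl | rfl <;> simp [hzdef]
      · simp [hzdef, hj]
    rcases Nat.lt_succ_iff_lt_or_eq.1 hi with hik | rfl
    · obtain ⟨a, b, ha, hb, hab⟩ := ih z (right_ne_zero_of_mul hz) hik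
      refine ⟨a, b, fun j => ?_, fun j => ?_, hab⟩
      · have := abs_sub_le (a j) (z j) (y j)
        have := ha j; have := hzy j
        push_cast; omega
      · have := abs_sub_le (b j) (z j) (y j)
        have := hb j; have := hzy j
        push_cast; omega
    · refine ⟨z, y, fun j => ?_, fun j => ?_, fun hc => ?_⟩
      · have := hzy j
        push_cast; omega
      · simp; positivity
      · apply left_ne_zero_of_mul hz
        rw [hc]
        exact CharTwo.add_self_eq_zero _

/-- The sign which the `i`-th coordinate has to have in an alternating face. -/
def alternatingSign (z : Fin N → ℤ) (i : Fin N) : ℤ :=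
  ∏ j ∈ Finset.univ.filter (· < i), if Odd (z j) then -1 else 1

/-- The condition on the `i`-th coordinate of `z` for lying in an alternating face
of the cube `[-m, m]^N`. -/
def alternatingFactor (m : ℤ) (z : Fin N → ℤ) (i : Fin N) : ZMod 2 :=
  if Odd (z i) then if z i = alternatingSign z i * m then 1 else 0
  else if |z i| < m then 1 else 0

/-- The indicator function of the faces of the cube `[-m, m]^N` whose nonfree coordinates have
the alternating signs `+, -, +, …`. -/
def alternatingFaces (m : ℤ) (z : Fin N → ℤ) : ZMod 2 :=
  ∏ i, alternatingFactor m z i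

theorem alternatingSign_eq_one_or (z : Fin N → ℤ) (i : Fin N) :
    alternatingSign z i = 1 ∨ alternatingSign z i = -1 := by
  unfold alternatingSign
  refine Finset.prod_induction _ (fun x : ℤ => x = 1 ∨ x = -1) ?_ (Or.inl rfl) ?_
  · rintro a b (rfl | rfl) (rfl | rfl) <;> simp
  · intro j _; split_ifs <;> simp

theorem alternatingSign_neg (z : Fin N → ℤ) (i : Fin N) :
    alternatingSign (-z) i = alternatingSign z i := by
  simp [alternatingSign]

theorem alternatingSign_eq_of_le {z w : Fin N → ℤ} {i j : Fin N} (hji : j ≤ i)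
    (h : ∀ l, l ≠ i → w l = z l) : alternatingSign w j = alternatingSign z j := by
  refine Finset.prod_congr rfl fun l hl => ?_
  rw [h l]
  have : l < j := by simpa using hl
  exact (this.trans_le hji).ne

theorem alternatingSign_eq_neg_of_lt {z w : Fin N → ℤ} {i j : Fin N} (hij : i < j)
    (h : ∀ l, l ≠ i → w l = z l) (hz : Odd (z i)) (hw : Even (w i)) :
    alternatingSign w j = -alternatingSign z j := by
  have hi : i ∈ Finset.univ.filter (· < j) := by simpa using hij
  unfold alternatingSign
  rw [← Finset.mul_prod_erase _ _ hi, ← Finset.mul_prod_erase _ _ hi, if_pos hz,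
    if_neg (Int.not_odd_iff_even.2 hw), one_mul, neg_one_mul, neg_neg]
  refine Finset.prod_congr rfl fun l hl => ?_
  rw [h l (Finset.ne_of_mem_erase hl)]

theorem alternatingFactor_neg (m : ℤ) (z : Fin N → ℤ) (i : Fin N) : alternatingFactor m (-z) i =
    if Odd (z i) then if z i = -alternatingSign z i * m then 1 else 0
    else if |z i| < m then 1 else 0 := by
  simp only [alternatingFactor, alternatingSign_neg, Pi.neg_apply, odd_neg, abs_neg, neg_mul,
    neg_eq_iff_eq_neg]

theorem prod_univ_eq_mul_lt_mul_gt (a : Fin N → ZMod 2) (i : Fin N) :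
    ∏ j, a j = a i * (∏ j ∈ Finset.univ.filter (· < i), a j) *
      ∏ j ∈ Finset.univ.filter (i < ·), a j := by
  rw [← Finset.prod_filter_mul_prod_filter_not Finset.univ (· < i), mul_comm (a i), mul_assoc]
  congr 1
  have : (Finset.univ.filter fun j => ¬ j < i) = insert i (Finset.univ.filter (i < ·)) := by
    ext j
    simp [le_iff_eq_or_lt, eq_comm]
  rw [this, Finset.prod_insert (by simp)]

/-- Freeing the coordinate `i` removes one sign change, so every later coordinate must have the
opposite sign: its factor becomes that of `-z`. -/
theorem alternatingFaces_of_free {m : ℤ} {z w : Fin N → ℤ} {i : Fin N}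
    (h : ∀ l, l ≠ i → w l = z l) (hz : Odd (z i)) (hw : Even (w i)) :
    alternatingFaces m w = (if |w i| < m then 1 else 0) *
      (∏ j ∈ Finset.univ.filter (· < i), alternatingFactor m z j) *
      ∏ j ∈ Finset.univ.filter (i < ·), alternatingFactor m (-z) j := by
  rw [alternatingFaces, prod_univ_eq_mul_lt_mul_gt _ i]
  congr 1
  · congr 1
    · simp [alternatingFactor, hw]
    · refine Finset.prod_congr rfl fun j hj => ?_
      have hj : j < i := by simpa using hj
      rw [alternatingFactor, alternatingFactor, h j hj.ne, alternatingSign_eq_of_le hj.le h]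
  · refine Finset.prod_congr rfl fun j hj => ?_
    have hj : i < j := by simpa using hj
    rw [alternatingFactor, alternatingFactor_neg, h j hj.ne',
      alternatingSign_eq_neg_of_lt hj h hz hw]

/-- The alternating faces act as hemispheres of each dimension: the boundary of one is the
hemisphere one dimension lower plus its antipode. -/
theorem cofacetSum_alternatingFaces {m : ℤ} (hm : Odd m) (hm0 : 0 < m) (z : Fin N → ℤ) :
    cofacetSum (alternatingFaces m) z = alternatingFaces m z + alternatingFaces m (-z) := by
  -- The product for `z` is turned into that for `-z` one coordinate at a time; the `i`-th
  -- difference is the contribution of the two cofacets in direction `i`.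
  have key := Finset.prod_add_ordered Finset.univ (alternatingFactor m (-z))
    (fun i => alternatingFactor m z i + alternatingFactor m (-z) i)
  have h1 : ∀ i, alternatingFactor m (-z) i +
      (alternatingFactor m z i + alternatingFactor m (-z) i) = alternatingFactor m z i := by
    intro i
    rw [add_left_comm, CharTwo.add_self_eq_zero, add_zero]
  simp only [h1] at key
  rw [alternatingFaces, alternatingFaces, key, add_right_comm, CharTwo.add_self_eq_zero, zero_add]
  refine Finset.sum_congr rfl fun i _ => ?_
  split_ifs with hi
  · rw [alternatingFaces_of_free (i := i) (z := z) (fun l hl => by simp [hl]) hi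
      (by simpa [Int.even_add, Int.not_even_iff_odd] using hi),
      alternatingFaces_of_free (i := i) (z := z) (fun l hl => by simp [hl]) hi
      (by simpa [Int.even_sub, Int.not_even_iff_odd] using hi), ← add_mul, ← add_mul]
    -- For odd `z i`, exactly one of `z i ± 1` lies in `(-m, m)` when `z i = ±m`, and otherwise both
    -- or neither do.
    congr 2
    have e1 : (z + Pi.single i 1 : Fin N → ℤ) i = z i + 1 := by simp
    have e2 : (z - Pi.single i 1 : Fin N → ℤ) i = z i - 1 := by simp
    rw [e1, e2, alternatingFactor, alternatingFactor_neg, if_pos hi, if_pos hi]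
    obtain ⟨p, rfl⟩ := hm
    obtain ⟨q, hq⟩ := hi
    rw [hq]
    have h2 : (1 : ZMod 2) + 1 = 0 := rfl
    simp only [abs_lt]
    rcases alternatingSign_eq_one_or z i with h | h <;> rw [h] <;> split_ifs <;>
      first | omega | simp [h2]
  · rw [alternatingFactor, alternatingFactor_neg, if_neg hi, if_neg hi,
      CharTwo.add_self_eq_zero, zero_mul, zero_mul]

theorem alternatingFaces_ne_zero {m : ℤ} {y : Fin N → ℤ} (h : alternatingFaces m y ≠ 0)
    (i : Fin N) : (Odd (y i) → y i = alternatingSign y i * m) ∧ (Even (y i) → |y i| < m) := by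
  have hi : alternatingFactor m y i ≠ 0 := fun h0 => h (Finset.prod_eq_zero (Finset.mem_univ i) h0)
  refine ⟨fun ho => ?_, fun he => ?_⟩
  · rw [alternatingFactor, if_pos ho] at hi
    by_contra hc
    exact hi (if_neg hc)
  · rw [alternatingFactor, if_neg (Int.not_odd_iff_even.2 he)] at hi
    by_contra hc
    exact hi (if_neg hc)

theorem abs_eq_of_alternatingFaces_ne_zero {m : ℤ} (hm0 : 0 < m) {y : Fin N → ℤ}
    (h : alternatingFaces m y ≠ 0) {i : Fin N} (hi : Odd (y i)) : |y i| = m := by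
  rw [(alternatingFaces_ne_zero h i).1 hi, abs_mul, abs_of_pos hm0]
  rcases alternatingSign_eq_one_or y i with h | h <;> simp [h]

/-- The integer points of the cube `[-m, m]^N`. -/
noncomputable def cubePoints (N : ℕ) (m : ℤ) : Finset (Fin N → ℤ) :=
  Fintype.piFinset fun _ => Finset.Icc (-m) m

theorem mem_cubePoints {m : ℤ} {y : Fin N → ℤ} : y ∈ cubePoints N m ↔ ∀ i, |y i| ≤ m := by
  simp [cubePoints, abs_le]

theorem mem_cubePoints_of_alternatingFaces_ne_zero {m : ℤ} (hm0 : 0 < m) {y : Fin N → ℤ}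
    (h : alternatingFaces m y ≠ 0) : y ∈ cubePoints N m := by
  refine mem_cubePoints.2 fun i => ?_
  rcases Int.even_or_odd (y i) with hi | hi
  · exact ((alternatingFaces_ne_zero h i).2 hi).le
  · exact (abs_eq_of_alternatingFaces_ne_zero hm0 h hi).le

theorem sum_alternatingFaces_mul_shift {m : ℤ} (hm0 : 0 < m) (f : (Fin N → ℤ) → ZMod 2)
    (i : Fin N) (ε : ℤ) (hε : ε = 1 ∨ ε = -1) :
    (∑ y ∈ cubePoints N m, if Even (y i) then alternatingFaces m y * f (y + Pi.single i ε) else 0) =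
    ∑ z ∈ cubePoints N m, if Odd (z i) then alternatingFaces m (z - Pi.single i ε) * f z else 0 := by
  have hpar : ∀ a : ℤ, Even a ↔ Odd (a + ε) := by
    intro a
    rcases hε with rfl | rfl <;> grind
  refine Finset.sum_bij_ne_zero (fun y _ _ => y + Pi.single i ε) ?_ ?_ ?_ ?_
  · intro y hy h
    obtain ⟨he, h⟩ := ite_ne_right_iff.1 h
    have hlt := (alternatingFaces_ne_zero (left_ne_zero_of_mul h) i).2 he
    refine mem_cubePoints.2 fun j => ?_
    by_cases hj : j = i
    · subst hj
      simp only [Pi.add_apply, Pi.single_eq_same]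
      rw [abs_lt] at hlt
      rw [abs_le]
      omega
    · simpa [hj] using mem_cubePoints.1 hy j
  · intro y _ _ z _ _ h
    exact add_right_cancel h
  · intro z hz h
    obtain ⟨ho, h⟩ := ite_ne_right_iff.1 h
    have hH : alternatingFaces m (z - Pi.single i ε) ≠ 0 := left_ne_zero_of_mul h
    have he : Even ((z - Pi.single i ε : Fin N → ℤ) i) := (hpar _).2 (by simpa using ho)
    have hz : z - Pi.single i ε + Pi.single i ε = z := sub_add_cancel _ _
    refine ⟨z - Pi.single i ε, mem_cubePoints_of_alternatingFaces_ne_zero hm0 hH, ?_, hz⟩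
    rwa [if_pos he, hz]
  · intro y _ _
    simp only [Pi.add_apply, Pi.single_eq_same, ← hpar, add_sub_cancel_right]

/-- Boundary and coboundary are adjoint. Truncation to the cube loses nothing, as free coordinates
satisfy `|y i| < m`. -/
theorem sum_alternatingFaces_mul_facetSum {m : ℤ} (hm0 : 0 < m) (f : (Fin N → ℤ) → ZMod 2) :
    ∑ y ∈ cubePoints N m, alternatingFaces m y * facetSum f y =
      ∑ z ∈ cubePoints N m, cofacetSum (alternatingFaces m) z * f z := by
  simp only [facetSum, cofacetSum, Finset.mul_sum, Finset.sum_mul]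
  rw [Finset.sum_comm, Finset.sum_comm (s := cubePoints N m)]
  refine Finset.sum_congr rfl fun i _ => ?_
  have h1 := sum_alternatingFaces_mul_shift hm0 f i 1 (Or.inl rfl)
  have h2 := sum_alternatingFaces_mul_shift hm0 f i (-1) (Or.inr rfl)
  simp only [Pi.single_neg, ← sub_eq_add_neg, sub_neg_eq_add] at h2
  have h3 := congrArg₂ (· + ·) h1 h2
  simp only [← Finset.sum_add_distrib] at h3
  convert h3 using 2 with y _ z _
  · split_ifs <;> ring
  · split_ifs <;> ring

theorem sum_alternatingFaces_mul_flagCount_zero {m : ℤ} (hm : Odd m) (hm0 : 0 < m) :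
    ∑ y ∈ cubePoints N m, alternatingFaces m y * flagCount s 0 y = 1 := by
  set c : Fin N → ℤ := alternatingSign fun _ => 1 with hc
  have hsign : ∀ y : Fin N → ℤ, (∀ i, Odd (y i)) → alternatingSign y = c := by
    intro y hy
    funext i
    simp [hc, alternatingSign, hy]
  have hc1 : ∀ i, c i = 1 ∨ c i = -1 := fun i => alternatingSign_eq_one_or _ i
  have hodd : ∀ i, Odd (c i * m) := by
    intro i
    rcases hc1 i with h | h <;> simpa [h] using hm
  have h1 : alternatingFaces m (fun i => c i * m) = 1 := by
    refine Finset.prod_eq_one fun i _ => ?_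
    rw [alternatingFactor, if_pos (hodd i), hsign _ hodd, if_pos rfl]
  rw [Finset.sum_eq_single fun i => c i * m]
  · rw [h1, one_mul]
    exact if_pos hodd
  · intro y _ hne
    by_contra h
    have hy : ∀ i, Odd (y i) := by
      by_contra h'
      exact right_ne_zero_of_mul h (if_neg h')
    refine hne (funext fun i => ?_)
    rw [(alternatingFaces_ne_zero (left_ne_zero_of_mul h) i).1 (hy i), hsign y hy]
  · intro h
    exact absurd (mem_cubePoints_of_alternatingFaces_ne_zero hm0 (by rw [h1]; exact one_ne_zero)) h

theorem sum_cubePoints_neg (m : ℤ) (f : (Fin N → ℤ) → ZMod 2) :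
    ∑ y ∈ cubePoints N m, f (-y) = ∑ y ∈ cubePoints N m, f y := by
  refine Finset.sum_nbij' (fun y => -y) (fun y => -y) ?_ ?_ ?_ ?_ ?_ <;>
    simp [mem_cubePoints]

/-- After moving the coboundary onto the chain, each antipodal pair contributes `s k z + s k (-z) =
1` times `c k`, which lowers `k` by one. -/
theorem sum_alternatingFaces_mul_flagCount {m : ℤ} (hm : Odd m) (hm0 : 0 < m)
    (hs : ∀ k z, z ≠ 0 → s k (-z) = s k z + 1) (k : ℕ) (hk : k ≤ N) :
    ∑ y ∈ cubePoints N m, alternatingFaces m y * flagCount s k y = 1 := by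
  induction k with
  | zero => exact sum_alternatingFaces_mul_flagCount_zero s hm hm0
  | succ k ih =>
    rw [← ih (by omega)]
    change ∑ y ∈ cubePoints N m, alternatingFaces m y * facetSum _ y = _
    rw [sum_alternatingFaces_mul_facetSum hm0]
    simp only [cofacetSum_alternatingFaces hm hm0, add_mul]
    rw [Finset.sum_add_distrib, ← sum_cubePoints_neg m fun z => alternatingFaces m (-z) * _,
      ← Finset.sum_add_distrib]
    refine Finset.sum_congr rfl fun z _ => ?_
    rw [neg_neg, flagCount_neg s hs k (by omega), ← mul_add, ← add_mul]
    by_cases h0 : flagCount s k z = 0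
    · simp [h0]
    · have hz : z ≠ 0 := by
        rintro rfl
        have := card_odd_of_flagCount_ne_zero s k 0 h0
        simp at this
        omega
      rw [hs k z hz, ← add_assoc, CharTwo.add_self_eq_zero, zero_add, one_mul]

/-- A combinatorial form of the Borsuk–Ulam theorem: `n` antipodal sign functions all change sign
near a common point of the boundary of the cube `[-m, m]^(n+1)`. -/
theorem exists_common_sign_change {n : ℕ} (s : ℕ → (Fin (n + 1) → ℤ) → ZMod 2)
    (hs : ∀ k z, z ≠ 0 → s k (-z) = s k z + 1) {m : ℤ} (hm : Odd m) (hm0 : 0 < m) :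
    ∃ y : Fin (n + 1) → ℤ, (∀ i, |y i| ≤ m) ∧ (∃ i, |y i| = m) ∧
      ∀ k < n, ∃ a b : Fin (n + 1) → ℤ, (∀ j, |a j - y j| ≤ n) ∧ (∀ j, |b j - y j| ≤ n) ∧
        s k a ≠ s k b := by
  have h := sum_alternatingFaces_mul_flagCount s hm hm0 hs n n.le_succ
  obtain ⟨y, hy, hne⟩ := Finset.exists_ne_zero_of_sum_ne_zero (h.trans_ne one_ne_zero)
  have hcard := card_odd_of_flagCount_ne_zero s n y (right_ne_zero_of_mul hne)
  obtain ⟨i, hi⟩ : (Finset.univ.filter fun i => Odd (y i)).Nonempty :=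
    Finset.card_pos.1 (by omega)
  exact ⟨y, mem_cubePoints.1 hy,
    ⟨i, abs_eq_of_alternatingFaces_ne_zero hm0 (left_ne_zero_of_mul hne) (by simpa using hi)⟩,
    exists_change_of_flagCount_ne_zero s n y (right_ne_zero_of_mul hne)⟩

end Cubical

/-! ### From the grid to closed subsets of the sphere. -/

section BorsukUlam

open Filter Topology

theorem exists_antipodal_selection {N : ℕ} (P : (Fin N → ℤ) → Prop)
    (hP : ∀ z, z ≠ 0 → P z ∨ P (-z)) : ∃ s : (Fin N → ℤ) → ZMod 2,
      (∀ z, z ≠ 0 → s (-z) = s z + 1) ∧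
      ∀ z, z ≠ 0 → (s z = 1 → P z) ∧ (s z = 0 → P (-z)) := by
  classical
  -- When both `z` and `-z` qualify, the lexicographic order breaks the tie antipodally.
  refine ⟨fun z => if (if P z ∧ P (-z) then 0 < toLex z else P z) then 1 else 0,
    fun z hz => ?_, fun z hz => ?_⟩
  · have h1 : 0 < toLex (-z) ↔ ¬ 0 < toLex z := by
      have hne : toLex z ≠ 0 := hz
      rw [toLex_neg, Left.neg_pos_iff]
      exact ⟨fun h => h.asymm, fun h => (lt_or_gt_of_ne hne).resolve_right h⟩
    have h2 : (1 : ZMod 2) + 1 = 0 := rfl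
    have := hP z hz
    simp only [neg_neg]
    by_cases hp : P z <;> by_cases hq : P (-z) <;> by_cases hl : 0 < toLex z <;>
      simp_all
  · have := hP z hz
    by_cases hp : P z <;> by_cases hq : P (-z) <;> simp_all

theorem exists_approx_common_antipodal {n : ℕ}
    (A : Fin n → Set (Fin (n + 1) → ℝ)) (hA : ∀ i x, x ≠ 0 → x ∈ A i ∨ -x ∈ A i)
    (hsmul : ∀ i x, ∀ c : ℝ, 0 < c → x ∈ A i → c • x ∈ A i) {ε : ℝ} (hε : 0 < ε) :
    ∃ u : Fin (n + 1) → ℝ, ‖u‖ = 1 ∧ ∀ k, ∃ p q : Fin (n + 1) → ℝ,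
      ‖p - u‖ ≤ ε ∧ ‖q - u‖ ≤ ε ∧ p ∈ A k ∧ -q ∈ A k := by
  have hsel := fun k : Fin n => exists_antipodal_selection
    (fun z : Fin (n + 1) → ℤ => (fun i => (z i : ℝ)) ∈ A k) (fun z hz => by
      have := hA k (fun i => (z i : ℝ)) (fun h => hz (funext fun i => by simpa using congrFun h i))
      simpa [Pi.neg_def] using this)
  choose s hs hsP using hsel
  -- Filler for the indices `k ≥ n`.
  obtain ⟨s₀, hs₀, -⟩ := exists_antipodal_selection (N := n + 1) (fun _ => True) (by simp)
  obtain ⟨j, hj⟩ := exists_nat_gt (n / ε)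
  -- Odd, larger than `n` so that points within `n` of the cube's boundary are nonzero, and with `n
  -- / m ≤ ε`.
  set m : ℕ := 2 * (j + n) + 1 with hm
  have hmpos : (0 : ℝ) < m := by positivity
  have hmn : (n : ℝ) / m ≤ ε := by
    rw [div_lt_iff₀ hε] at hj
    rw [div_le_iff₀ hmpos, hm]
    push_cast
    nlinarith [n.cast_nonneg (α := ℝ), j.cast_nonneg (α := ℝ)]
  obtain ⟨y, hy, ⟨i, hi⟩, hy'⟩ := exists_common_sign_change (n := n)
    (fun k => if h : k < n then s ⟨k, h⟩ else s₀)
    (fun k z hz => by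
      by_cases h : k < n
      · simpa [h] using hs ⟨k, h⟩ z hz
      · simpa [h] using hs₀ z hz) (m := m) (by simp [hm]) (by positivity)
  have hclose : ∀ a : Fin (n + 1) → ℤ, (∀ j, |a j - y j| ≤ n) →
      a ≠ 0 ∧ ‖(m : ℝ)⁻¹ • (fun i => (a i : ℝ)) - (m : ℝ)⁻¹ • (fun i => (y i : ℝ))‖ ≤ ε := by
    intro a ha
    constructor
    · rintro rfl
      have := ha i
      simp only [Pi.zero_apply, zero_sub, abs_neg, hi] at this
      omega
    · refine le_trans ?_ hmn
      rw [pi_norm_le_iff_of_nonneg (by positivity)]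
      intro j
      have : (|a j - y j| : ℝ) ≤ n := by exact_mod_cast ha j
      simp only [Pi.sub_apply, Pi.smul_apply, smul_eq_mul, ← mul_sub, norm_mul, norm_inv,
        Real.norm_natCast]
      rw [div_eq_inv_mul, Real.norm_eq_abs]
      gcongr
  refine ⟨(m : ℝ)⁻¹ • fun i => (y i : ℝ), le_antisymm ?_ ?_, fun k => ?_⟩
  · rw [pi_norm_le_iff_of_nonneg zero_le_one]
    intro j
    have : (|y j| : ℝ) ≤ m := by exact_mod_cast hy j
    simp only [Pi.smul_apply, smul_eq_mul, norm_mul, norm_inv, Real.norm_natCast]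
    rwa [inv_mul_le_iff₀ hmpos, mul_one, Real.norm_eq_abs]
  · refine le_trans ?_ (norm_le_pi_norm _ i)
    have : (|y i| : ℝ) = m := by exact_mod_cast hi
    simp only [Pi.smul_apply, smul_eq_mul, norm_mul, norm_inv, Real.norm_natCast]
    rw [Real.norm_eq_abs, this, inv_mul_cancel₀ hmpos.ne']
  · have h2 : ∀ a b : Fin (n + 1) → ℤ, s k a ≠ s k b →
        (s k a = 1 ∧ s k b = 0) ∨ (s k b = 1 ∧ s k a = 0) := by
      intro a b h
      generalize s k a = α at h
      generalize s k b = β at h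
      revert α β
      decide
    have hmem : ∀ a b : Fin (n + 1) → ℤ, a ≠ 0 → b ≠ 0 → s k a = 1 → s k b = 0 →
        (m : ℝ)⁻¹ • (fun i => (a i : ℝ)) ∈ A k ∧ -((m : ℝ)⁻¹ • (fun i => (b i : ℝ))) ∈ A k := by
      intro a b ha hb h1 h0
      refine ⟨hsmul k _ _ (by positivity) ((hsP k a ha).1 h1), ?_⟩
      rw [← smul_neg]
      refine hsmul k _ _ (by positivity) ?_
      have := (hsP k b hb).2 h0
      simpa [Pi.neg_def] using this
    obtain ⟨a, b, ha, hb, hab⟩ := hy' k k.2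
    simp only [k.2, dif_pos] at hab
    obtain ⟨ha0, ha⟩ := hclose a ha
    obtain ⟨hb0, hb⟩ := hclose b hb
    rcases h2 a b hab with ⟨h1, h0⟩ | ⟨h1, h0⟩
    · exact ⟨_, _, ha, hb, hmem a b ha0 hb0 h1 h0⟩
    · exact ⟨_, _, hb, ha, hmem b a hb0 ha0 h1 h0⟩

/-- The Borsuk–Ulam theorem, for closed subsets of the sphere `Sⁿ` each of which covers
the sphere together with its antipodal set. -/
theorem exists_mem_and_neg_mem_of_closed_cover {n : ℕ}
    (A : Fin n → Set (EuclideanSpace ℝ (Fin (n + 1)))) (hclosed : ∀ i, IsClosed (A i))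
    (hA : ∀ i x, ‖x‖ = 1 → x ∈ A i ∨ -x ∈ A i) :
    ∃ x : EuclideanSpace ℝ (Fin (n + 1)), ‖x‖ = 1 ∧ ∀ i, x ∈ A i ∧ -x ∈ A i := by
  -- Radial projection, taking the sup-norm sphere to the Euclidean one.
  set ν : (Fin (n + 1) → ℝ) → EuclideanSpace ℝ (Fin (n + 1)) :=
    fun x => ‖WithLp.toLp 2 x‖⁻¹ • WithLp.toLp 2 x with hν
  have hνneg : ∀ x, ν (-x) = -ν x := by
    intro x
    simp [hν, WithLp.toLp_neg]
  have hνsmul : ∀ x, ∀ c : ℝ, 0 < c → ν (c • x) = ν x := by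
    intro x c hc
    simp only [hν, WithLp.toLp_smul, norm_smul, Real.norm_of_nonneg hc.le, smul_smul]
    congr 1
    field_simp
  have hνnorm : ∀ x, x ≠ 0 → ‖ν x‖ = 1 := by
    intro x hx
    have : WithLp.toLp 2 x ≠ 0 := by simpa using hx
    exact norm_smul_inv_norm (𝕜 := ℝ) this
  have hνcont : ∀ x, x ≠ 0 → ContinuousAt ν x := by
    intro x hx
    have h : WithLp.toLp 2 x ≠ 0 := by simpa using hx
    have hc : Continuous fun x : Fin (n + 1) → ℝ => WithLp.toLp 2 x :=
      PiLp.continuous_toLp 2 _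
    exact (hc.continuousAt.norm.inv₀ (by simpa using h)).smul hc.continuousAt
  have happ := fun j : ℕ => exists_approx_common_antipodal (fun i => ν ⁻¹' A i)
    (fun i x hx => by simpa [hνneg] using hA i (ν x) (hνnorm x hx))
    (fun i x c hc hx => by simpa [hνsmul x c hc] using hx)
    (ε := 1 / ((j : ℝ) + 1)) (by positivity)
  choose u hu p q hp hq hpA hqA using happ
  obtain ⟨x, hx, φ, hφ, hlim⟩ := (isCompact_sphere (0 : Fin (n + 1) → ℝ) 1).tendsto_subseq
    (x := u) (fun j => by simpa using hu j)
  have hx0 : x ≠ 0 := by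
    rintro rfl
    simp at hx
  have hε : Tendsto (fun j => 1 / ((φ j : ℝ) + 1)) atTop (𝓝 0) :=
    tendsto_one_div_add_atTop_nhds_zero_nat.comp hφ.tendsto_atTop
  have hconv : ∀ r : ℕ → Fin (n + 1) → ℝ, (∀ j, ‖r j - u j‖ ≤ 1 / ((j : ℝ) + 1)) →
      Tendsto (fun j => ν (r (φ j))) atTop (𝓝 (ν x)) := by
    intro r hr
    refine (hνcont x hx0).tendsto.comp ?_
    have h0 : Tendsto (fun j => r (φ j) - u (φ j)) atTop (𝓝 0) :=
      squeeze_zero_norm (fun j => hr (φ j)) hε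
    simpa using h0.add hlim
  refine ⟨ν x, hνnorm x hx0, fun i => ⟨?_, ?_⟩⟩
  · exact (hclosed i).mem_of_tendsto (hconv (fun j => p j i) fun j => hp j i)
      (Eventually.of_forall fun j => hpA (φ j) i)
  · refine (hclosed i).mem_of_tendsto (hconv (fun j => q j i) fun j => hq j i).neg
      (Eventually.of_forall fun j => ?_)
    simpa [hνneg] using hqA (φ j) i

end BorsukUlam

/-! ### Masses of half-spaces and bisecting directions. -/

section HalfSpaces

open Filter Topology

variable {n : ℕ}

/-- The mass of the closed half-space `{x | t ≤ ⟪u, x⟫}`. -/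
noncomputable def halfSpaceMass (μ : Measure (EuclideanSpace ℝ (Fin n)))
    (u : EuclideanSpace ℝ (Fin n)) (t : ℝ) : ℝ :=
  μ.real {x | t ≤ inner ℝ u x}

theorem volume_hyperplane_eq_zero {u : EuclideanSpace ℝ (Fin n)} (hu : u ≠ 0) (t : ℝ) :
    volume {x : EuclideanSpace ℝ (Fin n) | inner ℝ u x = t} = 0 := by
  let S : AffineSubspace ℝ (EuclideanSpace ℝ (Fin n)) :=
    { carrier := {x | inner ℝ u x = t}
      smul_vsub_vadd_mem' := by
        intro c p q r hp hq hr
        simp only [Set.mem_ofPred_eq] at hp hq hr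
        simp [inner_add_right, inner_smul_right, inner_sub_right, hp, hq, hr] }
  refine Measure.addHaar_affineSubspace volume S fun hS => ?_
  have h : ((t + 1) / ‖u‖ ^ 2) • u ∈ S := hS ▸ AffineSubspace.mem_top ℝ _ _
  have h' : inner ℝ u (((t + 1) / ‖u‖ ^ 2) • u) = t := h
  rw [inner_smul_right, real_inner_self_eq_norm_sq,
    div_mul_cancel₀ _ (pow_ne_zero 2 (norm_ne_zero_iff.2 hu))] at h'
  linarith

theorem measurableSet_halfSpace (u : EuclideanSpace ℝ (Fin n)) (t : ℝ) :
    MeasurableSet {x : EuclideanSpace ℝ (Fin n) | t ≤ inner ℝ u x} :=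
  (isClosed_le continuous_const (continuous_const.inner continuous_id)).measurableSet

theorem halfSpaceMass_antitone (μ : Measure (EuclideanSpace ℝ (Fin n))) [IsFiniteMeasure μ]
    (u : EuclideanSpace ℝ (Fin n)) : Antitone (halfSpaceMass μ u) :=
  fun _ _ h => measureReal_mono fun _ hx => h.trans hx

namespace IsMassDistribution

variable {μ ν : Measure (EuclideanSpace ℝ (Fin n))}

/-- Indicators of half-spaces converge off the limiting hyperplane, which is null by absolute
continuity. -/
theorem continuousOn_halfSpaceMass (hμ : IsMassDistribution μ) :
    ContinuousOn (fun p : EuclideanSpace ℝ (Fin n) × ℝ => halfSpaceMass μ p.1 p.2)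
      {p | p.1 ≠ 0} := by
  have := hμ.finite
  rintro ⟨u, t⟩ hu
  refine ContinuousAt.continuousWithinAt ?_
  refine (ENNReal.tendsto_toReal (measure_ne_top _ _)).comp ?_
  refine tendsto_measure_of_ae_tendsto_indicator_of_isFiniteMeasure _
    (measurableSet_halfSpace u t) (fun p => measurableSet_halfSpace p.1 p.2) ?_
  have hnull : ∀ᵐ x ∂μ, inner ℝ u x ≠ t :=
    measure_eq_zero_iff_ae_notMem.1 (hμ.absolutelyContinuous (volume_hyperplane_eq_zero hu t))
  filter_upwards [hnull] with x hx
  have hc : Continuous fun p : EuclideanSpace ℝ (Fin n) × ℝ => inner ℝ p.1 x :=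
    continuous_fst.inner continuous_const
  rcases lt_or_gt_of_ne hx with h | h
  · filter_upwards [hc.continuousAt.eventually_lt continuous_snd.continuousAt h] with p hp
    exact iff_of_false hp.not_ge h.not_ge
  · filter_upwards [continuous_snd.continuousAt.eventually_lt hc.continuousAt h] with p hp
    exact iff_of_true hp.le h.le

theorem continuous_halfSpaceMass (hμ : IsMassDistribution μ) {u : EuclideanSpace ℝ (Fin n)}
    (hu : u ≠ 0) : Continuous (halfSpaceMass μ u) :=
  hμ.continuousOn_halfSpaceMass.comp_continuous (f := fun t => (u, t)) (by fun_prop) fun _ => hu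

theorem measureReal_negHalfSpace (hμ : IsMassDistribution μ) {u : EuclideanSpace ℝ (Fin n)}
    (hu : u ≠ 0) (t : ℝ) :
    μ.real {x | inner ℝ u x ≤ t} = μ.real Set.univ - halfSpaceMass μ u t := by
  have := hμ.finite
  rw [halfSpaceMass, ← measureReal_compl (measurableSet_halfSpace u t)]
  refine measureReal_congr ?_
  have hnull : ∀ᵐ x ∂μ, inner ℝ u x ≠ t :=
    measure_eq_zero_iff_ae_notMem.1 (hμ.absolutelyContinuous (volume_hyperplane_eq_zero hu t))
  filter_upwards [hnull] with x hx
  refine propext ?_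
  change inner ℝ u x ≤ t ↔ ¬ t ≤ inner ℝ u x
  rw [not_le]
  exact ⟨fun h => lt_of_le_of_ne h hx, le_of_lt⟩

theorem halfSpaceMass_neg (hμ : IsMassDistribution μ) {u : EuclideanSpace ℝ (Fin n)}
    (hu : u ≠ 0) (t : ℝ) :
    halfSpaceMass μ (-u) (-t) = μ.real Set.univ - halfSpaceMass μ u t := by
  rw [← hμ.measureReal_negHalfSpace hu, halfSpaceMass]
  simp only [inner_neg_left, neg_le_neg_iff]

theorem bisects_of_halfSpaceMass_eq (hμ : IsMassDistribution μ) (H : Hyperplane n)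
    (h : halfSpaceMass μ H.normal H.offset = μ.real Set.univ / 2) : H.Bisects μ := by
  have := hμ.finite
  have hu : H.normal ≠ 0 := by
    intro h0
    simpa [h0] using H.norm_normal
  have key : ∀ s, μ.real s = μ.real Set.univ / 2 → μ s = μ Set.univ / 2 := by
    intro s hs
    rw [← ENNReal.toReal_eq_toReal_iff' (measure_ne_top _ _)
      (ENNReal.div_ne_top (measure_ne_top _ _) two_ne_zero), ENNReal.toReal_div]
    exact hs
  refine ⟨key _ h, key _ ?_⟩
  rw [Hyperplane.negHalfSpace, hμ.measureReal_negHalfSpace hu, h]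
  ring

/-- By tightness all but a quarter of the mass lies in a ball, which a half-space far from the
origin misses. -/
theorem exists_halfSpaceMass_lt (hμ : IsMassDistribution μ) (h0 : μ ≠ 0) :
    ∃ R : ℝ, ∀ u : EuclideanSpace ℝ (Fin n), ‖u‖ = 1 → ∀ t, R < t →
      halfSpaceMass μ u t < μ.real Set.univ / 2 := by
  have := hμ.finite
  have hpos : 0 < μ.real Set.univ := by
    have : NeZero μ := ⟨h0⟩
    exact measureReal_univ_pos
  obtain ⟨K, hK, hμK⟩ := isTightMeasureSet_iff_exists_isCompact_measure_compl_le.1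
    (isTightMeasureSet_singleton (μ := μ)) (ENNReal.ofReal (μ.real Set.univ / 4)) (by positivity)
  obtain ⟨R, hR⟩ := hK.isBounded.subset_closedBall 0
  refine ⟨R, fun u hu t ht => ?_⟩
  have h1 : halfSpaceMass μ u t ≤ μ.real Kᶜ := by
    refine measureReal_mono fun x hx hxK => ?_
    have h2 : ‖x‖ ≤ R := by simpa using hR hxK
    have h3 := real_inner_le_norm u x
    rw [hu, one_mul] at h3
    have h4 : t ≤ inner ℝ u x := hx
    linarith
  have h2 : μ.real Kᶜ ≤ μ.real Set.univ / 4 :=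
    ENNReal.toReal_le_of_le_ofReal (by positivity) (hμK μ rfl)
  linarith

theorem exists_abs_le_of_halfSpaceMass_eq (hμ : IsMassDistribution μ) (h0 : μ ≠ 0) :
    ∃ R : ℝ, ∀ u : EuclideanSpace ℝ (Fin n), ‖u‖ = 1 →
      ∀ t, halfSpaceMass μ u t = μ.real Set.univ / 2 → |t| ≤ R := by
  obtain ⟨R, hR⟩ := hμ.exists_halfSpaceMass_lt h0
  refine ⟨R, fun u hu t ht => abs_le.2 ⟨?_, ?_⟩⟩
  · by_contra! h
    have hu0 : u ≠ 0 := norm_ne_zero_iff.1 (by simp [hu])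
    have h1 := hR (-u) (by simpa using hu) (-t) (by linarith)
    rw [hμ.halfSpaceMass_neg hu0, ht] at h1
    linarith
  · by_contra! h
    exact (hR u hu t h).ne ht

theorem exists_halfSpaceMass_eq (hμ : IsMassDistribution μ) (h0 : μ ≠ 0)
    {u : EuclideanSpace ℝ (Fin n)} (hu : ‖u‖ = 1) :
    ∃ t, halfSpaceMass μ u t = μ.real Set.univ / 2 := by
  obtain ⟨R, hR⟩ := hμ.exists_halfSpaceMass_lt h0
  have hu0 : u ≠ 0 := norm_ne_zero_iff.1 (by simp [hu])
  have h1 := hR u hu (R + 1) (by linarith)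
  have h2 := hR (-u) (by simpa using hu) (R + 1) (by linarith)
  rw [← neg_neg (R + 1), hμ.halfSpaceMass_neg hu0] at h2
  exact mem_range_of_exists_le_of_exists_ge (hμ.continuous_halfSpaceMass hu0) ⟨_, h1.le⟩
    ⟨-(R + 1), by linarith⟩

end IsMassDistribution

/-- The directions of hyperplanes which bisect `μ` and whose positive half-space
contains at least half of `ν`. -/
def bisectingDirections (μ ν : Measure (EuclideanSpace ℝ (Fin n))) :
    Set (EuclideanSpace ℝ (Fin n)) :=
  {u | ‖u‖ = 1 ∧ ∃ t, halfSpaceMass μ u t = μ.real Set.univ / 2 ∧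
    ν.real Set.univ / 2 ≤ halfSpaceMass ν u t}

namespace IsMassDistribution

variable {μ ν : Measure (EuclideanSpace ℝ (Fin n))}

/-- Bisecting offsets are uniformly bounded, so this set is the projection of a compact set of pairs
`(u, t)`. -/
theorem isClosed_bisectingDirections (hμ : IsMassDistribution μ) (hν : IsMassDistribution ν)
    (h0 : μ ≠ 0) : IsClosed (bisectingDirections μ ν) := by
  obtain ⟨R, hR⟩ := hμ.exists_abs_le_of_halfSpaceMass_eq h0
  set K : Set (EuclideanSpace ℝ (Fin n) × ℝ) := Metric.sphere 0 1 ×ˢ Set.Icc (-R) R with hK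
  have hKc : IsCompact K := (isCompact_sphere _ _).prod isCompact_Icc
  have hK0 : K ⊆ {p | p.1 ≠ 0} := by
    rintro ⟨u, t⟩ ⟨hu, -⟩
    have hu : ‖u‖ = 1 := by simpa using hu
    exact norm_ne_zero_iff.1 (by simp [hu])
  have h1 := (hμ.continuousOn_halfSpaceMass.mono hK0).preimage_isClosed_of_isClosed hKc.isClosed
    (isClosed_singleton (x := μ.real Set.univ / 2))
  have h2 := (hν.continuousOn_halfSpaceMass.mono hK0).preimage_isClosed_of_isClosed hKc.isClosed
    (isClosed_Ici (a := ν.real Set.univ / 2))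
  have h3 := (hKc.of_isClosed_subset (h1.inter h2)
    (Set.inter_subset_left.trans Set.inter_subset_left)).image continuous_fst
  convert h3.isClosed
  ext u
  constructor
  · rintro ⟨hu, t, ht, ht'⟩
    have hmem : (u, t) ∈ K := ⟨by simpa using hu, abs_le.1 (hR u hu t ht)⟩
    exact ⟨(u, t), ⟨⟨hmem, ht⟩, ⟨hmem, ht'⟩⟩, rfl⟩
  · rintro ⟨⟨u, t⟩, ⟨⟨hmem, ht⟩, ⟨-, ht'⟩⟩, rfl⟩
    exact ⟨by simpa using hmem.1, t, ht, ht'⟩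

theorem mem_bisectingDirections_or_neg_mem (hμ : IsMassDistribution μ)
    (hν : IsMassDistribution ν) (h0 : μ ≠ 0) {u : EuclideanSpace ℝ (Fin n)} (hu : ‖u‖ = 1) :
    u ∈ bisectingDirections μ ν ∨ -u ∈ bisectingDirections μ ν := by
  have hu0 : u ≠ 0 := norm_ne_zero_iff.1 (by simp [hu])
  obtain ⟨t, ht⟩ := hμ.exists_halfSpaceMass_eq h0 hu
  rcases le_total (ν.real Set.univ / 2) (halfSpaceMass ν u t) with h | h
  · exact Or.inl ⟨hu, t, ht, h⟩
  · refine Or.inr ⟨by simpa using hu, -t, ?_, ?_⟩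
    · rw [hμ.halfSpaceMass_neg hu0, ht]
      ring
    · rw [hν.halfSpaceMass_neg hu0]
      linarith

theorem exists_bisects_of_mem_of_neg_mem (hμ : IsMassDistribution μ)
    (hν : IsMassDistribution ν) {u : EuclideanSpace ℝ (Fin n)}
    (h : u ∈ bisectingDirections μ ν) (h' : -u ∈ bisectingDirections μ ν) :
    ∃ H : Hyperplane n, H.normal = u ∧ H.Bisects μ ∧ H.Bisects ν := by
  have := hμ.finite
  obtain ⟨hu, a, ha, ha'⟩ := h
  obtain ⟨-, b, hb, hb'⟩ := h'
  have hu0 : u ≠ 0 := norm_ne_zero_iff.1 (by simp [hu])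
  rw [← neg_neg b, hμ.halfSpaceMass_neg hu0] at hb
  rw [← neg_neg b, hν.halfSpaceMass_neg hu0] at hb'
  obtain ⟨t, ht, htν⟩ := intermediate_value_uIcc (a := -b) (b := a)
    (hν.continuous_halfSpaceMass hu0).continuousOn
    (Set.Icc_subset_uIcc ⟨by linarith, ha'⟩ : ν.real Set.univ / 2 ∈ _)
  -- The bisecting offset of `μ` need not be unique, but by monotonicity everything between two of
  -- them bisects.
  have htμ : halfSpaceMass μ u t = μ.real Set.univ / 2 := by
    have hb2 : halfSpaceMass μ u (-b) = μ.real Set.univ / 2 := by linarith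
    have hanti := halfSpaceMass_antitone μ u
    rcases Set.mem_uIcc.1 ht with ⟨h1, h2⟩ | ⟨h1, h2⟩
    · exact le_antisymm ((hanti h1).trans hb2.le) (ha.ge.trans (hanti h2))
    · exact le_antisymm ((hanti h1).trans ha.le) (hb2.ge.trans (hanti h2))
  exact ⟨⟨u, hu, t⟩, rfl, hμ.bisects_of_halfSpaceMass_eq _ htμ,
    hν.bisects_of_halfSpaceMass_eq _ htν⟩

theorem restrict_ball (c : EuclideanSpace ℝ (Fin n)) :
    IsMassDistribution (volume.restrict (Metric.ball c 1)) :=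
  ⟨⟨by simpa using measure_ball_lt_top⟩, Measure.restrict_le_self.absolutelyContinuous⟩

end IsMassDistribution

theorem restrict_ball_ne_zero (c : EuclideanSpace ℝ (Fin n)) :
    (volume.restrict (Metric.ball c 1) : Measure (EuclideanSpace ℝ (Fin n))) ≠ 0 := by
  rw [Ne, Measure.restrict_eq_zero]
  exact (Metric.measure_ball_pos volume c one_pos).ne'

theorem offset_le_of_bisects_ball {c u : EuclideanSpace ℝ (Fin n)} (hu : ‖u‖ = 1) {t : ℝ}
    (hpos : volume.restrict (Metric.ball c 1) {x | t ≤ inner ℝ u x} =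
      volume.restrict (Metric.ball c 1) Set.univ / 2)
    (hneg : volume.restrict (Metric.ball c 1) {x | inner ℝ u x ≤ t} =
      volume.restrict (Metric.ball c 1) Set.univ / 2) : t ≤ inner ℝ u c := by
  by_contra! hlt
  set μ := (volume.restrict (Metric.ball c 1) : Measure (EuclideanSpace ℝ (Fin n))) with hμ
  have : IsFiniteMeasure μ := (IsMassDistribution.restrict_ball c).finite
  set d : ℝ := t - inner ℝ u c with hd
  have hd0 : 0 < d := sub_pos.2 hlt
  set A : Set (EuclideanSpace ℝ (Fin n)) := {x | inner ℝ u x ≤ inner ℝ u c - d} with hA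
  have hAmeas : MeasurableSet A :=
    (isClosed_le (continuous_const.inner continuous_id) continuous_const).measurableSet
  -- Reflection `x ↦ 2c - x` preserves the ball and maps `A` to the positive half-space. Thus `A`
  -- has half the mass, and the small ball `B` adds more within the negative half-space.
  have hAeq : μ A = μ Set.univ / 2 := by
    rw [← hpos, hμ, Measure.restrict_apply hAmeas,
      Measure.restrict_apply (measurableSet_halfSpace u t)]
    have hmp := Measure.measurePreserving_sub_left
      (volume : Measure (EuclideanSpace ℝ (Fin n))) (c + c)
    rw [← hmp.measure_preimage
      ((measurableSet_halfSpace u t).inter Metric.isOpen_ball.measurableSet).nullMeasurableSet]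
    congr 1
    ext x
    simp only [hA, hd, Set.mem_inter_iff, Set.mem_ofPred_eq, Set.mem_preimage, Metric.mem_ball,
      inner_sub_right, inner_add_right, dist_eq_norm]
    refine and_congr ⟨fun h => by linarith, fun h => by linarith⟩ ?_
    rw [← norm_neg, show -(x - c) = c + c - x - c by abel]
  set B := Metric.ball c (min d 1) with hB
  have hr : 0 < min d 1 := lt_min hd0 one_pos
  have hBpos : 0 < μ B := by
    rw [hμ, Measure.restrict_apply Metric.isOpen_ball.measurableSet,
      Set.inter_eq_left.2 (Metric.ball_subset_ball (min_le_right _ _))]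
    exact Metric.measure_ball_pos volume c hr
  have hBd : ∀ x ∈ B, |inner ℝ u x - inner ℝ u c| < d := by
    intro x hx
    rw [← inner_sub_right]
    refine (abs_real_inner_le_norm _ _).trans_lt ?_
    rw [hu, one_mul, ← dist_eq_norm]
    exact (Metric.mem_ball.1 hx).trans_le (min_le_left _ _)
  have hdisj : Disjoint A B := by
    rw [Set.disjoint_left]
    intro x hxA hxB
    have h1 := (abs_lt.1 (hBd x hxB)).1
    have h2 : inner ℝ u x ≤ inner ℝ u c - d := hxA
    linarith
  have hsub : A ∪ B ⊆ {x | inner ℝ u x ≤ t} := by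
    rintro x (hx | hx)
    · have h2 : inner ℝ u x ≤ inner ℝ u c - d := hx
      change inner ℝ u x ≤ t
      linarith
    · have h1 := (abs_lt.1 (hBd x hx)).2
      change inner ℝ u x ≤ t
      linarith
  have h1 := measure_mono (μ := μ) hsub
  rw [measure_union hdisj Metric.isOpen_ball.measurableSet, hneg, hAeq] at h1
  exact h1.not_gt (ENNReal.lt_add_right
    (ENNReal.div_ne_top (measure_ne_top _ _) two_ne_zero) hBpos.ne')

theorem Hyperplane.Bisects.offset_eq_of_ball {H : Hyperplane n} {c : EuclideanSpace ℝ (Fin n)}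
    (h : H.Bisects (volume.restrict (Metric.ball c 1))) : H.offset = inner ℝ H.normal c := by
  refine le_antisymm (offset_le_of_bisects_ball H.norm_normal h.1 h.2) ?_
  have := offset_le_of_bisects_ball (c := c) (u := -H.normal) (t := -H.offset)
    (by simpa using H.norm_normal) (by simp only [inner_neg_left, neg_le_neg_iff]; exact h.2)
    (by simp only [inner_neg_left, neg_le_neg_iff]; exact h.1)
  simpa [inner_neg_left] using this

end HalfSpaces

/-! ### Orthogonal frames from division algebras, and the upper bound. -/

section Frames

variable {n : ℕ}

theorem mem_orthogonalBisectionNumbers_of_frame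
    (J : Fin n → EuclideanSpace ℝ (Fin (n + 1)) → EuclideanSpace ℝ (Fin (n + 1)))
    (hcont : ∀ i, Continuous (J i)) (hneg : ∀ i v, J i (-v) = -J i v)
    (hnorm : ∀ i v, ‖J i v‖ = ‖v‖) (horth : ∀ i j v, i ≠ j → inner ℝ (J i v) (J j v) = 0) :
    n ∈ orthogonalBisectionNumbers 2 (n + 1) := by
  intro μ hμ
  obtain ⟨ν, hν, hν0, hνbis⟩ : ∃ ν : Measure (EuclideanSpace ℝ (Fin (n + 1))),
      IsMassDistribution ν ∧ ν ≠ 0 ∧ ∀ H : Hyperplane (n + 1), H.Bisects ν → H.Bisects (μ 0) := by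
    -- Every hyperplane bisects the zero measure, so its bisecting offsets are unbounded; a ball
    -- replaces it.
    by_cases h0 : μ 0 = 0
    · exact ⟨_, IsMassDistribution.restrict_ball 0, restrict_ball_ne_zero 0,
        fun H _ => by simp [Hyperplane.Bisects, h0]⟩
    · exact ⟨μ 0, hμ 0, h0, fun _ h => h⟩
  obtain ⟨v, hv, hvA⟩ := exists_mem_and_neg_mem_of_closed_cover
    (fun i => J i ⁻¹' bisectingDirections ν (μ 1))
    (fun i => (hν.isClosed_bisectingDirections (hμ 1) hν0).preimage (hcont i))
    (fun i v hv => by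
      simpa [hneg] using
        hν.mem_bisectingDirections_or_neg_mem (hμ 1) hν0 ((hnorm i v).trans hv))
  have hex := fun i => hν.exists_bisects_of_mem_of_neg_mem (hμ 1) (hvA i).1
    (by simpa [hneg] using (hvA i).2)
  choose H hH hHν hHμ using hex
  refine ⟨H, fun i j hij => ?_, fun i j => ?_⟩
  · rw [Hyperplane.perp, Hyperplane.perp, Submodule.isOrtho_span]
    simpa [hH] using horth i j v hij
  · fin_cases j
    · exact hνbis _ (hHν i)
    · exact hHμ i

/-- The hypotheses on `π` and `ε` are finite checks, left to `decide`. Orthogonality holds because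
the involution `π i ∘ π j` reverses the sign of each summand of the inner product. -/
theorem mem_orthogonalBisectionNumbers_of_signed_perm (π : Fin n → Fin (n + 1) → Fin (n + 1))
    (ε : Fin n → Fin (n + 1) → ℤ) (hε : ∀ i a, ε i a * ε i a = 1)
    (hinv : ∀ i a, π i (π i a) = a) (hcomm : ∀ i j a, π i (π j a) = π j (π i a))
    (hanti : ∀ i j a, i ≠ j → ε i (π i (π j a)) * ε j (π i (π j a)) = -(ε i a * ε j a)) :
    n ∈ orthogonalBisectionNumbers 2 (n + 1) := by
  refine mem_orthogonalBisectionNumbers_of_frame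
    (fun i v => WithLp.toLp 2 fun a => (ε i a : ℝ) * v (π i a)) ?_ ?_ ?_ ?_
  · intro i
    fun_prop
  · intro i v
    ext a
    simp
  · intro i v
    rw [EuclideanSpace.norm_eq, EuclideanSpace.norm_eq]
    congr 1
    rw [← Equiv.sum_comp (Function.Involutive.toPerm (π i) (hinv i)) fun a => ‖v a‖ ^ 2]
    refine Finset.sum_congr rfl fun a _ => ?_
    have h : (ε i a : ℝ) * ε i a = 1 := by exact_mod_cast hε i a
    simp only [Real.norm_eq_abs, sq_abs]
    rw [mul_pow, sq (ε i a : ℝ), h, one_mul]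
    rfl
  · intro i j v hij
    have hinv' : Function.Involutive fun a => π i (π j a) := by
      intro a
      simp only
      rw [hcomm j i, hinv, hinv]
    have h := Equiv.sum_comp (Function.Involutive.toPerm _ hinv')
      fun a => ((ε i a : ℝ) * v (π i a)) * (ε j a * v (π j a))
    have h' : ∀ a, ((ε i (π i (π j a)) : ℝ) * v (π i (π i (π j a)))) *
        (ε j (π i (π j a)) * v (π j (π i (π j a)))) =
        -(((ε i a : ℝ) * v (π i a)) * (ε j a * v (π j a))) := by
      intro a
      have h1 : (ε i (π i (π j a)) : ℝ) * ε j (π i (π j a)) = -(ε i a * ε j a) := by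
        exact_mod_cast hanti i j a hij
      rw [hinv, hcomm i j, hinv, ← hcomm i j]
      linear_combination (v (π j a) * v (π i a)) * h1
    simp only [Function.Involutive.coe_toPerm, h', Finset.sum_neg_distrib] at h
    have h2 : inner ℝ (WithLp.toLp 2 fun a => (ε i a : ℝ) * v (π i a))
        (WithLp.toLp 2 fun a => (ε j a : ℝ) * v (π j a)) =
        ∑ a, ((ε i a : ℝ) * v (π i a)) * (ε j a * v (π j a)) := by
      simp [PiLp.inner_apply, mul_comm]
    rw [h2]
    linarith

/-- The signs of the left multiplications by the imaginary units of the octonions: the `a`-th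
coordinate of `eᵢ₊₁ * v` is `octonionSign i a * v (a xor (i + 1))`. The upper left corners
give the quaternions and the complex numbers. -/
def octonionSign : Matrix (Fin 7) (Fin 8) ℤ :=
  !![-1, 1, -1, 1, -1, 1, 1, -1;
    -1, 1, 1, -1, -1, -1, 1, 1;
    -1, -1, 1, 1, -1, 1, -1, 1;
    -1, 1, 1, 1, 1, -1, -1, -1;
    -1, -1, 1, -1, 1, 1, 1, -1;
    -1, -1, -1, 1, 1, -1, 1, 1;
    -1, 1, -1, -1, 1, 1, -1, 1]

theorem one_mem_orthogonalBisectionNumbers : 1 ∈ orthogonalBisectionNumbers 2 2 :=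
  mem_orthogonalBisectionNumbers_of_signed_perm (fun i a => i.succ ^^^ a)
    (fun i a => octonionSign (i.castLE (by decide)) (a.castLE (by decide)))
    (by decide) (by decide) (by decide) (by decide)

theorem three_mem_orthogonalBisectionNumbers : 3 ∈ orthogonalBisectionNumbers 2 4 :=
  mem_orthogonalBisectionNumbers_of_signed_perm (fun i a => i.succ ^^^ a)
    (fun i a => octonionSign (i.castLE (by decide)) (a.castLE (by decide)))
    (by decide) (by decide) (by decide) (by decide)

set_option maxRecDepth 4000 in
theorem seven_mem_orthogonalBisectionNumbers : 7 ∈ orthogonalBisectionNumbers 2 8 :=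
  mem_orthogonalBisectionNumbers_of_signed_perm (fun i a => i.succ ^^^ a) octonionSign
    (by decide) (by decide) (by decide) (by decide)

/-- Test on unit balls around `0` and `c ≠ 0`: bisectors contain both centres, so the orthonormal
normals lie in the `n`-dimensional complement of `c`. -/
theorem le_of_mem_orthogonalBisectionNumbers {k : ℕ}
    (h : k ∈ orthogonalBisectionNumbers 2 (n + 1)) : k ≤ n := by
  set c : EuclideanSpace ℝ (Fin (n + 1)) := EuclideanSpace.single 0 1 with hc
  have hc0 : c ≠ 0 := by simp [hc]
  obtain ⟨H, horth, hH⟩ := h ![volume.restrict (Metric.ball 0 1), volume.restrict (Metric.ball c 1)]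
    (by
      intro j
      fin_cases j
      · exact IsMassDistribution.restrict_ball 0
      · exact IsMassDistribution.restrict_ball c)
  have hperp : ∀ i, inner ℝ c (H i).normal = 0 := by
    intro i
    have h0 := (show (H i).Bisects _ from hH i 0).offset_eq_of_ball
    have h1 := (show (H i).Bisects _ from hH i 1).offset_eq_of_ball
    rw [real_inner_comm, ← h1, h0, inner_zero_right]
  have hon : Orthonormal ℝ fun i => (H i).normal := by
    refine ⟨fun i => (H i).norm_normal, fun i j hij => ?_⟩
    have := horth i j hij
    rw [Hyperplane.perp, Hyperplane.perp, Submodule.isOrtho_span] at this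
    exact this rfl rfl
  have hle : Submodule.span ℝ (Set.range fun i => (H i).normal) ≤ (ℝ ∙ c)ᗮ := by
    rw [Submodule.span_le]
    rintro _ ⟨i, rfl⟩
    exact Submodule.mem_orthogonal_singleton_iff_inner_right.2 (hperp i)
  have hfin := Submodule.finrank_mono hle
  have : Fact (Module.finrank ℝ (EuclideanSpace ℝ (Fin (n + 1))) = n + 1) :=
    ⟨finrank_euclideanSpace_fin⟩
  rwa [finrank_span_eq_card hon.linearIndependent, Fintype.card_fin,
    Submodule.finrank_orthogonal_span_singleton (n := n) hc0] at hfin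

end Frames
end MassPartition

/-- `Ω^⊥(2; 2, n) = n - 1` for `n = 2, 4, 8`. -/
theorem mainTheorem8 (n : ℕ) (hn : n = 2 ∨ n = 4 ∨ n = 8) :
    IsGreatest (MassPartition.orthogonalBisectionNumbers 2 n) (n - 1) := by
  rcases hn with rfl | rfl | rfl
  · exact ⟨MassPartition.one_mem_orthogonalBisectionNumbers,
      fun k hk => MassPartition.le_of_mem_orthogonalBisectionNumbers hk⟩
  · exact ⟨MassPartition.three_mem_orthogonalBisectionNumbers,
      fun k hk => MassPartition.le_of_mem_orthogonalBisectionNumbers hk⟩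
  · exact ⟨MassPartition.seven_mem_orthogonalBisectionNumbers,
      fun k hk => MassPartition.le_of_mem_orthogonalBisectionNumbers hk⟩
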